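/- Let $G$ be a finite or countable group and let $S\subset G$ be a finite non-empty symmetric generating set ($S=S^{-1}$), with $d=|S|$. The simple random walk on $G$ is the Markov chain with transition probabilities $p_{\rm SRW}(y,z)=\frac1d$ if $z\in yS$ and $0$ otherwise; the lazy random walk is the Markov chain with transition matrix $\frac12(P_{\rm SRW}+I)$. Let $(X_n)_{n\ge 0}$ be either of these walks, let $\mathbb P_x$ denote its law on trajectories when $X_0=x$, and let $\mathcal T=\bigcap_{n}\sigma(X_n,X_{n+1},\dots)$ be its tail $\sigma$-algebra. Call a bounded function $u:G\to\mathbb R$ harmonic if $u(y)=\frac1d\sum_{s\in S}u(ys)$ for every $y\in G$. **Theorem.** For each of the two walks (simple and lazy) and every starting point $x\in G$, the tail $\sigma$-algebra $\mathcal T$ is trivial under $\mathbb P_x$ (that is, $\mathbb P_x(A)\in\{0,1\}$ for every $A\in\mathcal T$) if and only if every bounded harmonic function on $G$ is constant. -/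

import Mathlib

open MeasureTheory
open scoped ENNReal

namespace GroupWalk

noncomputable section

variable {G : Type*} [Group G]

/-- The step law of simple random walk: uniform on the finite set `S`. -/
def srwStep (S : Finset G) (hS : S.Nonempty) : PMF G :=
  PMF.uniformOfFinset S hS

/-- The step law of lazy random walk: toss a fair coin and either stay put (the increment is the
identity), or make a step of simple random walk. -/
def lazyStep (S : Finset G) (hS : S.Nonempty) : PMF G :=
  (PMF.uniformOfFintype Bool).bind fun b => if b then PMF.pure 1 else srwStep S hS

/-- The trajectory `X 0 = x`, `X (n + 1) = X n * ξ n` with starting point `x` and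
increments `ξ`. -/
def walk (x : G) (ξ : ℕ → G) : ℕ → G
  | 0 => x
  | n + 1 => walk x ξ n * ξ n

/-- The law `ℙ_x`, on the space of trajectories, of the random walk that starts at `x` and has
independent increments of law `ν`. It is the Markov chain with transition probabilities
`p (y, z) = ν (y⁻¹ * z)`. -/
def walkLaw [MeasurableSpace G] (ν : PMF G) (x : G) : Measure (ℕ → G) :=
  (Measure.infinitePi fun _ : ℕ => ν.toMeasure).map (walk x)

/-- The tail σ-algebra `⋂ n, σ(X n, X (n + 1), …)` of the coordinate process on the space of
trajectories. -/
@[reducible] def tailSigma (G : Type*) [MeasurableSpace G] : MeasurableSpace (ℕ → G) :=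
  ⨅ n : ℕ, ⨆ k : ℕ, ⨆ _ : n ≤ k, MeasurableSpace.comap (fun X : ℕ → G => X k) inferInstance

/-- Triviality of a σ-algebra `F` under a probability measure `P`: each event of `F` has
probability `0` or `1`. -/
def IsTrivialUnder {Ω : Type*} {m : MeasurableSpace Ω} (P : Measure Ω) (F : MeasurableSpace Ω) :
    Prop :=
  ∀ A : Set Ω, MeasurableSet[F] A → P A = 0 ∨ P A = 1

/-- `u` is harmonic for the simple random walk: `u x` is the average of `u` over the neighbours
`x * s`, `s ∈ S`, of `x` in the right Cayley graph. -/
def IsHarmonic (S : Finset G) (u : G → ℝ) : Prop :=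
  ∀ x : G, u x = (1 / (S.card : ℝ)) * ∑ s ∈ S, u (x * s)

/-- Every bounded harmonic function is constant. -/
def BoundedHarmonicConstant (S : Finset G) : Prop :=
  ∀ u : G → ℝ, (∃ C : ℝ, ∀ x, |u x| ≤ C) → IsHarmonic S u → ∃ c : ℝ, ∀ x, u x = c

theorem measurable_walk [Countable G] [MeasurableSpace G] [DiscreteMeasurableSpace G] (x : G) :
    Measurable (walk x) := by
  refine measurable_pi_lambda _ fun n => ?_
  induction n with
  | zero => exact measurable_const
  | succ n ih => exact ih.mul (measurable_pi_apply n)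

instance [Countable G] [MeasurableSpace G] [DiscreteMeasurableSpace G] (ν : PMF G) (x : G) :
    IsProbabilityMeasure (walkLaw ν x) :=
  Measure.isProbabilityMeasure_map (measurable_walk x).aemeasurable

theorem tailSigma_le (G : Type*) [MeasurableSpace G] :
    tailSigma G ≤ (inferInstance : MeasurableSpace (ℕ → G)) :=
  (iInf_le _ 0).trans <| iSup_le fun k => iSup_le fun _ => (measurable_pi_apply k).comap_le

end

end GroupWalk

namespace GroupWalk

open scoped Pointwise

variable {G : Type*} [Group G]

/-! Both walks are treated at once, as a walk whose step law has finite symmetric generating support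
`T`; laziness does not change the harmonic functions.

Liouville implies trivial tail: a tail event `A` yields a bounded space-time harmonic function, the
probability of `A` given that the walk is at `y` at time `n`. Since `s * s⁻¹ = 1`, Harnack's
inequality makes it 2-periodic in time (`le_add_period`), so up to parity it is an ordinary harmonic
function, hence constant on reachable points (`exists_const`). Then `A` is independent of every
cylinder, so of itself.

Trivial tail implies Liouville: for each level `r`, the walk visits `{r ≤ u}` infinitely often with
probability 0 or 1. A minimum principle gives `u ≤ r` or `r ≤ u` everywhere, so `u` takes one value.
Neither direction uses martingale convergence. -/

/-- The average of `f` over a step from `y` with law `ν`, for `ν` carried by the finite set `T`. -/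
noncomputable def stepAvg (ν : PMF G) (T : Finset G) (f : G → ℝ) (y : G) : ℝ :=
  ∑ s ∈ T, (ν s).toReal * f (y * s)

/-- `f n y` is harmonic for the space-time walk with step law `ν`. -/
def IsSpaceTimeHarmonic (ν : PMF G) (T : Finset G) (f : ℕ → G → ℝ) : Prop :=
  ∀ n y, f n y = stepAvg ν T (f (n + 1)) y

variable {ν : PMF G} {T : Finset G}

theorem sum_pmf_eq_one {G : Type*} {ν : PMF G} {T : Finset G} (hT : ∀ s, s ∈ T ↔ ν s ≠ 0) : ∑ s ∈ T, ν s = 1 := by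
  rw [← ν.tsum_coe, tsum_eq_sum]
  intro s hs
  simpa [hT] using hs

theorem sum_toReal_eq_one {G : Type*} {ν : PMF G} {T : Finset G} (hT : ∀ s, s ∈ T ↔ ν s ≠ 0) : ∑ s ∈ T, (ν s).toReal = 1 := by
  rw [← ENNReal.toReal_sum fun s _ => ν.apply_ne_top s, sum_pmf_eq_one hT, ENNReal.toReal_one]

theorem toReal_pos_of_mem {G : Type*} {ν : PMF G} {T : Finset G} (hT : ∀ s, s ∈ T ↔ ν s ≠ 0) {s : G} (hs : s ∈ T) :
    0 < (ν s).toReal :=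
  ENNReal.toReal_pos ((hT s).1 hs) (ν.apply_ne_top s)

theorem stepAvg_const (hT : ∀ s, s ∈ T ↔ ν s ≠ 0) (c : ℝ) (y : G) :
    stepAvg ν T (fun _ => c) y = c := by
  rw [stepAvg, ← Finset.sum_mul, sum_toReal_eq_one hT, one_mul]

theorem stepAvg_sub (f g : G → ℝ) (y : G) :
    stepAvg ν T (fun z => f z - g z) y = stepAvg ν T f y - stepAvg ν T g y := by
  simp only [stepAvg, mul_sub, Finset.sum_sub_distrib]

theorem stepAvg_neg (f : G → ℝ) (y : G) :
    stepAvg ν T (fun z => -f z) y = -stepAvg ν T f y := by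
  simp only [stepAvg, mul_neg, Finset.sum_neg_distrib]

/-! ### Harnack inequality and periodicity in time -/

/-- Harnack inequality along a word of length `k`. -/
theorem exists_harnack (hT : ∀ s, s ∈ T ↔ ν s ≠ 0) (k : ℕ) {g : G} (hg : g ∈ (T : Set G) ^ k) :
    ∃ a : ℝ, 0 < a ∧ ∀ e : ℕ → G → ℝ, IsSpaceTimeHarmonic ν T e → (∀ n y, 0 ≤ e n y) →
      ∀ n y, a * e (n + k) (y * g) ≤ e n y := by
  induction k generalizing g with
  | zero =>
    rw [pow_zero, Set.mem_one] at hg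
    subst hg
    exact ⟨1, one_pos, fun e _ _ n y => by simp⟩
  | succ k ih =>
    rw [pow_succ] at hg
    obtain ⟨g, hg, s, hs, rfl⟩ := hg
    obtain ⟨a, ha, h⟩ := ih hg
    refine ⟨a * (ν s).toReal, mul_pos ha (toReal_pos_of_mem hT hs), fun e he h0 n y => ?_⟩
    refine le_trans ?_ (h e he h0 n y)
    rw [mul_assoc, he (n + k) (y * g)]
    refine mul_le_mul_of_nonneg_left ?_ ha.le
    have := Finset.single_le_sum (f := fun s => (ν s).toReal * e (n + k + 1) (y * g * s))
      (fun i _ => mul_nonneg ENNReal.toReal_nonneg (h0 _ _)) (Finset.mem_coe.1 hs)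
    simpa [stepAvg, mul_assoc, add_assoc] using this

theorem IsSpaceTimeHarmonic.shift {f : ℕ → G → ℝ} (hf : IsSpaceTimeHarmonic ν T f) (k : ℕ) :
    IsSpaceTimeHarmonic ν T fun n => f (n + k) := by
  intro n y
  have := hf (n + k) y
  rwa [add_right_comm] at this

theorem IsSpaceTimeHarmonic.neg {f : ℕ → G → ℝ} (hf : IsSpaceTimeHarmonic ν T f) :
    IsSpaceTimeHarmonic ν T fun n y => -f n y := by
  intro n y
  rw [stepAvg_neg, ← hf n y]

theorem IsSpaceTimeHarmonic.sub {f g : ℕ → G → ℝ} (hf : IsSpaceTimeHarmonic ν T f)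
    (hg : IsSpaceTimeHarmonic ν T g) : IsSpaceTimeHarmonic ν T fun n y => f n y - g n y := by
  intro n y
  rw [stepAvg_sub, ← hf n y, ← hg n y]

/-- If the drop `f n y - f (n + k) y` had supremum `L > 0`, Harnack applied to `L` minus the drop
would keep the drop at least `L / 2` at many successive times over a near-maximal point. These drops
telescope, contradicting boundedness. -/
theorem IsSpaceTimeHarmonic.le_add_period (hT : ∀ s, s ∈ T ↔ ν s ≠ 0) {f : ℕ → G → ℝ}
    (hf : IsSpaceTimeHarmonic ν T f) {C : ℝ} (hC : ∀ n y, |f n y| ≤ C) {k : ℕ}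
    (hk : (1 : G) ∈ (T : Set G) ^ k) (n : ℕ) (y : G) : f n y ≤ f (n + k) y := by
  obtain ⟨a, ha, harnack⟩ := exists_harnack hT k hk
  set h : ℕ × G → ℝ := fun p => f p.1 p.2 - f (p.1 + k) p.2 with hdef
  have hbdd : BddAbove (Set.range h) := by
    refine ⟨2 * C, ?_⟩
    rintro _ ⟨p, rfl⟩
    have h1 := abs_le.1 (hC p.1 p.2)
    have h2 := abs_le.1 (hC (p.1 + k) p.2)
    simp only [hdef]
    linarith
  set L := sSup (Set.range h) with hL
  have hle : ∀ p, h p ≤ L := fun p => le_csSup hbdd ⟨p, rfl⟩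
  suffices L ≤ 0 by
    have := (hle (n, y)).trans this
    simp only [hdef] at this
    linarith
  by_contra! hpos
  have he : IsSpaceTimeHarmonic ν T fun n y => L - h (n, y) := by
    have h1 : IsSpaceTimeHarmonic ν T fun _ _ => L := fun n y => (stepAvg_const hT L y).symm
    exact h1.sub (hf.sub (hf.shift k))
  have he0 : ∀ n y, 0 ≤ L - h (n, y) := fun n y => sub_nonneg.2 (hle _)
  have hstep : ∀ n y, a * (L - h (n + k, y)) ≤ L - h (n, y) := fun n y => by
    simpa using harnack _ he he0 n y
  have hiter : ∀ j n y, a ^ j * (L - h (n + j * k, y)) ≤ L - h (n, y) := by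
    intro j
    induction j with
    | zero => intro n y; simp
    | succ j ih =>
      intro n y
      refine le_trans ?_ (ih n y)
      rw [pow_succ, mul_assoc]
      refine mul_le_mul_of_nonneg_left ?_ (by positivity)
      have := hstep (n + j * k) y
      rwa [add_assoc, ← Nat.succ_mul] at this
  -- Enough drops of size `L / 2` to exceed `2 * C`, the largest possible oscillation of `f`.
  obtain ⟨m, hm⟩ := exists_nat_gt (2 * C / (L / 2))
  rw [div_lt_iff₀ (by positivity)] at hm
  -- One Harnack constant for all `m` iterates, fixed before the near-maximal point, whose precision
  -- depends on it.
  obtain ⟨b, hb, hbj⟩ : ∃ b : ℝ, 0 < b ∧ ∀ j < m, b ≤ a ^ j := by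
    clear hm
    induction m with
    | zero => exact ⟨1, one_pos, by simp⟩
    | succ m ih =>
      obtain ⟨b, hb, h⟩ := ih
      refine ⟨min b (a ^ m), lt_min hb (by positivity), fun j hj => ?_⟩
      rcases Nat.lt_succ_iff_lt_or_eq.1 hj with hj | rfl
      · exact (min_le_left _ _).trans (h j hj)
      · exact min_le_right _ _
  obtain ⟨_, ⟨⟨n₀, y₀⟩, rfl⟩, hlt⟩ := exists_lt_of_lt_csSup (Set.range_nonempty h)
    (show L - b * (L / 2) < L by have := mul_pos hb (half_pos hpos); linarith)
  have hlow : ∀ j < m, L / 2 ≤ h (n₀ + j * k, y₀) := by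
    intro j hj
    have h1 := hiter j n₀ y₀
    have h2 := mul_le_mul_of_nonneg_right (hbj j hj) (he0 (n₀ + j * k) y₀)
    have h3 : b * (L - h (n₀ + j * k, y₀)) < b * (L / 2) := by linarith
    have := lt_of_mul_lt_mul_left h3 hb.le
    linarith
  have hsum : ∀ i ≤ m, i * (L / 2) ≤ f n₀ y₀ - f (n₀ + i * k) y₀ := by
    intro i
    induction i with
    | zero => simp
    | succ i ih =>
      intro hi
      have h1 := ih (by omega)
      have h2 := hlow i (by omega)
      simp only [hdef] at h2
      rw [add_assoc, ← Nat.succ_mul] at h2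
      push_cast
      rw [Nat.succ_eq_add_one] at h2
      linarith
  have h1 := hsum m le_rfl
  have h2 := abs_le.1 (hC n₀ y₀)
  have h3 := abs_le.1 (hC (n₀ + m * k) y₀)
  linarith

theorem IsSpaceTimeHarmonic.eq_add_period (hT : ∀ s, s ∈ T ↔ ν s ≠ 0) {f : ℕ → G → ℝ}
    (hf : IsSpaceTimeHarmonic ν T f) {C : ℝ} (hC : ∀ n y, |f n y| ≤ C) {k : ℕ}
    (hk : (1 : G) ∈ (T : Set G) ^ k) (n : ℕ) (y : G) : f (n + k) y = f n y := by
  refine le_antisymm ?_ (hf.le_add_period hT hC hk n y)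
  have := hf.neg.le_add_period hT (C := C) (by simpa using hC) hk n y
  linarith

/-! ### Parity: from space-time harmonic to harmonic functions -/

theorem inv_mem_pow (hinv : ∀ s ∈ T, s⁻¹ ∈ T) {k : ℕ} {g : G} (hg : g ∈ (T : Set G) ^ k) :
    g⁻¹ ∈ (T : Set G) ^ k := by
  have : (T : Set G)⁻¹ = T := by
    ext s
    refine ⟨fun h => ?_, fun h => hinv s h⟩
    simpa using hinv _ h
  rw [← Set.mem_inv, ← inv_pow, this]
  exact hg

theorem exists_mem_pow (hinv : ∀ s ∈ T, s⁻¹ ∈ T) (hgen : Subgroup.closure (T : Set G) = ⊤) (g : G) :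
    ∃ k, g ∈ (T : Set G) ^ k := by
  have hg : g ∈ Subgroup.closure (T : Set G) := hgen ▸ Subgroup.mem_top g
  induction hg using Subgroup.closure_induction_right with
  | one => exact ⟨0, by simp⟩
  | mul_right x _ y hy ih =>
    obtain ⟨k, hk⟩ := ih
    exact ⟨k + 1, pow_succ (T : Set G) k ▸ Set.mul_mem_mul hk hy⟩
  | mul_inv_cancel x _ y hy ih =>
    obtain ⟨k, hk⟩ := ih
    exact ⟨k + 1, pow_succ (T : Set G) k ▸ Set.mul_mem_mul hk (hinv y hy)⟩

/-- If bounded harmonic functions are constant, a bounded space-time harmonic function takes a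
single value at the space-time points that the walk from `x` reaches. -/
theorem IsSpaceTimeHarmonic.exists_const (hT : ∀ s, s ∈ T ↔ ν s ≠ 0) (hinv : ∀ s ∈ T, s⁻¹ ∈ T)
    (hne : T.Nonempty) (hgen : Subgroup.closure (T : Set G) = ⊤)
    (hL : ∀ u : G → ℝ, (∃ C : ℝ, ∀ y, |u y| ≤ C) → (∀ y, u y = stepAvg ν T u y) →
      ∃ c : ℝ, ∀ y, u y = c)
    {f : ℕ → G → ℝ} (hf : IsSpaceTimeHarmonic ν T f) {C : ℝ} (hC : ∀ n y, |f n y| ≤ C) (x : G) :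
    ∃ c : ℝ, ∀ n, ∀ g ∈ (T : Set G) ^ n, f n (x * g) = c := by
  classical
  have htwo : (1 : G) ∈ (T : Set G) ^ 2 := by
    obtain ⟨s, hs⟩ := hne
    rw [pow_two]
    exact ⟨s, hs, s⁻¹, hinv s hs, mul_inv_cancel s⟩
  have hper : ∀ n y, f (n + 2) y = f n y := hf.eq_add_period hT hC htwo
  have heven : ∀ j n y, f (n + 2 * j) y = f n y := by
    intro j
    induction j with
    | zero => simp
    | succ j ih => intro n y; rw [mul_add, mul_one, ← add_assoc, hper, ih]
  -- A loop of odd length adds an odd period to the period 2, so `f` does not depend on time.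
  by_cases hodd : ∃ k, Odd k ∧ (1 : G) ∈ (T : Set G) ^ k
  · obtain ⟨k, ⟨j, rfl⟩, hk⟩ := hodd
    have hone : ∀ n y, f (n + 1) y = f n y := fun n y => by
      rw [← hf.eq_add_period hT hC hk n y, ← heven j (n + 1) y]
      congr 1
      ring
    have hzero : ∀ n y, f n y = f 0 y := by
      intro n
      induction n with
      | zero => simp
      | succ n ih => intro y; rw [hone, ih]
    obtain ⟨c, hc⟩ := hL (f 0) ⟨C, hC 0⟩ fun y => by
      have : f (0 + 1) = f 0 := funext (hone 0)
      conv_lhs => rw [hf 0 y, this]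
    exact ⟨c, fun n g _ => by rw [hzero, hc]⟩
  -- Without odd loops the Cayley graph is bipartite, with `E` the even elements. Gluing `f 0` on `x
  -- * E` to `f 1` off it gives a harmonic function.
  · set E : Set G := {g | ∃ j, g ∈ (T : Set G) ^ (2 * j)} with hE
    have hEo : ∀ {g j}, g ∈ (T : Set G) ^ (2 * j + 1) → g ∉ E := by
      rintro g j hg ⟨i, hi⟩
      refine hodd ⟨2 * i + (2 * j + 1), by rw [← add_assoc, ← mul_add]; exact odd_two_mul_add_one _,
        ?_⟩
      rw [pow_add]
      exact ⟨g, hi, g⁻¹, inv_mem_pow hinv hg, mul_inv_cancel g⟩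
    have hstep : ∀ g, ∀ s ∈ T, (g * s ∈ E ↔ g ∉ E) := by
      intro g s hs
      obtain ⟨k, hk⟩ := exists_mem_pow hinv hgen g
      have hks : g * s ∈ (T : Set G) ^ (k + 1) := pow_succ (T : Set G) k ▸ Set.mul_mem_mul hk hs
      rcases Nat.even_or_odd' k with ⟨j, rfl | rfl⟩
      · exact iff_of_false (hEo hks) (not_not.2 ⟨j, hk⟩)
      · exact iff_of_true ⟨j + 1, hks⟩ (hEo hk)
    obtain ⟨c, hc⟩ := hL (fun y => if x⁻¹ * y ∈ E then f 0 y else f 1 y)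
      ⟨C, fun y => by split_ifs <;> exact hC _ _⟩ fun y => by
        have h2 : f (1 + 1) = f 0 := funext (hper 0)
        unfold stepAvg
        by_cases hy : x⁻¹ * y ∈ E
        · rw [if_pos hy, hf 0 y, stepAvg]
          refine Finset.sum_congr rfl fun s hs => ?_
          beta_reduce
          rw [← mul_assoc, if_neg (by rw [hstep _ s hs]; exact not_not.2 hy)]
        · rw [if_neg hy, hf 1 y, stepAvg, h2]
          refine Finset.sum_congr rfl fun s hs => ?_
          beta_reduce
          rw [← mul_assoc, if_pos ((hstep _ s hs).2 hy)]
    refine ⟨c, fun n g hg => ?_⟩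
    have := hc (x * g)
    simp only [inv_mul_cancel_left] at this
    rcases Nat.even_or_odd' n with ⟨j, rfl | rfl⟩
    · rw [if_pos ⟨j, hg⟩] at this
      rw [← this, ← heven j 0, zero_add]
    · rw [if_neg (hEo hg)] at this
      rw [← this, ← heven j 1, add_comm]

/-! ### First-step decomposition of i.i.d. sequences and of the walk -/

/-- The sequence that starts with `s` and goes on with `ξ`. -/
def consSeq {α : Type*} (s : α) (ξ : ℕ → α) : ℕ → α
  | 0 => s
  | n + 1 => ξ n

theorem measurable_consSeq {α : Type*} [MeasurableSpace α] (s : α) : Measurable (consSeq s) := by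
  refine measurable_pi_lambda _ fun n => ?_
  cases n with
  | zero => exact measurable_const
  | succ n => exact measurable_pi_apply n

theorem eq_infinitePi_of_range {α : Type*} [MeasurableSpace α] {μ : Measure α}
    [IsProbabilityMeasure μ] {ρ : Measure (ℕ → α)}
    (h : ∀ (n : ℕ) (t : ℕ → Set α), (∀ i, MeasurableSet (t i)) →
      ρ {ξ | ∀ i < n, ξ i ∈ t i} = ∏ i ∈ Finset.range n, μ (t i)) :
    ρ = Measure.infinitePi fun _ => μ := by
  classical
  refine Measure.eq_infinitePi _ fun s t ht => ?_
  obtain ⟨n, hn⟩ := s.exists_nat_subset_range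
  have := h n (fun i => if i ∈ s then t i else Set.univ)
    fun i => by split_ifs <;> [exact ht i; exact .univ]
  convert this using 1
  · congr 1
    ext ξ
    simp only [Set.mem_pi, Finset.mem_coe, Set.mem_ofPred_eq]
    refine ⟨fun hξ i _ => ?_, fun hξ i hi => ?_⟩
    · split_ifs with hi
      · exact hξ i hi
      · trivial
    · have := hξ i (Finset.mem_range.1 (hn hi))
      rwa [if_pos hi] at this
  · rw [← Finset.prod_subset hn]
    · exact Finset.prod_congr rfl fun i hi => by rw [if_pos hi]
    · intro i _ hi
      rw [if_neg hi, measure_univ]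

theorem infinitePi_range {α : Type*} [MeasurableSpace α] (μ : Measure α)
    [IsProbabilityMeasure μ] (n : ℕ) {t : ℕ → Set α} (ht : ∀ i, MeasurableSet (t i)) :
    (Measure.infinitePi fun _ : ℕ => μ) {ξ | ∀ i < n, ξ i ∈ t i} =
      ∏ i ∈ Finset.range n, μ (t i) := by
  rw [← Measure.infinitePi_pi (fun _ : ℕ => μ) (s := Finset.range n) fun i _ => ht i]
  congr 1
  ext ξ
  simp

variable [Countable G] [MeasurableSpace G] [DiscreteMeasurableSpace G]

open Classical in
theorem toMeasure_eq_sum {α : Type*} [MeasurableSpace α] [DiscreteMeasurableSpace α]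
    {ν : PMF α} {T : Finset α} (hT : ∀ s, s ∈ T ↔ ν s ≠ 0) (A : Set α) :
    ν.toMeasure A = ∑ s ∈ T, ν s * if s ∈ A then 1 else 0 := by
  rw [ν.toMeasure_apply (.of_discrete), tsum_eq_sum (s := T)]
  · refine Finset.sum_congr rfl fun s _ => ?_
    by_cases h : s ∈ A <;> simp [h]
  · intro s hs
    have : ν s = 0 := by simpa [hT] using hs
    simp [Set.indicator_apply, this]

open Classical in
theorem setOf_forall_consSeq {α : Type*} (s : α) (n : ℕ) (t : ℕ → Set α) :
    consSeq s ⁻¹' {ξ | ∀ i < n + 1, ξ i ∈ t i} =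
      if s ∈ t 0 then {ξ | ∀ i < n, ξ i ∈ t (i + 1)} else ∅ := by
  ext ξ
  simp only [Set.mem_preimage, Set.mem_ofPred_eq, Nat.forall_lt_succ_left]
  split_ifs with h
  · exact ⟨fun hξ => hξ.2, fun hξ => ⟨h, hξ⟩⟩
  · exact iff_of_false (fun hξ => h hξ.1) id

theorem measurableSet_forall_lt {α : Type*} [MeasurableSpace α] (n : ℕ) {t : ℕ → Set α}
    (ht : ∀ i, MeasurableSet (t i)) : MeasurableSet {ξ : ℕ → α | ∀ i < n, ξ i ∈ t i} := by
  have : {ξ : ℕ → α | ∀ i < n, ξ i ∈ t i} = Set.pi (Finset.range n) t := by ext; simp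
  rw [this]
  exact MeasurableSet.pi (Finset.countable_toSet _) fun i _ => ht i

/-- An i.i.d. sequence is a first term followed by an i.i.d. sequence. -/
theorem infinitePi_eq_sum_consSeq {α : Type*} [MeasurableSpace α] [DiscreteMeasurableSpace α]
    {ν : PMF α} {T : Finset α} (hT : ∀ s, s ∈ T ↔ ν s ≠ 0) {E : Set (ℕ → α)}
    (hE : MeasurableSet E) :
    (Measure.infinitePi fun _ : ℕ => ν.toMeasure) E =
      ∑ s ∈ T, ν s * (Measure.infinitePi fun _ : ℕ => ν.toMeasure) (consSeq s ⁻¹' E) := by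
  classical
  have key : (∑ s ∈ T, ν s • (Measure.infinitePi fun _ : ℕ => ν.toMeasure).map (consSeq s)) =
      Measure.infinitePi fun _ : ℕ => ν.toMeasure := by
    refine eq_infinitePi_of_range fun n t ht => ?_
    simp only [Measure.finsetSum_apply, Measure.smul_apply, smul_eq_mul]
    simp_rw [Measure.map_apply (measurable_consSeq _) (measurableSet_forall_lt n ht)]
    cases n with
    | zero => simp [sum_pmf_eq_one hT]
    | succ n =>
      rw [Finset.prod_range_succ', toMeasure_eq_sum hT, mul_comm, Finset.sum_mul]
      refine Finset.sum_congr rfl fun s _ => ?_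
      rw [setOf_forall_consSeq, mul_assoc]
      congr 1
      split_ifs
      · rw [infinitePi_range _ n fun i => ht (i + 1), one_mul]
      · simp
  conv_lhs => rw [← key]
  simp only [Measure.finsetSum_apply, Measure.smul_apply, smul_eq_mul]
  simp_rw [Measure.map_apply (measurable_consSeq _) hE]

theorem walk_consSeq {G : Type*} [Group G] (y s : G) (ξ : ℕ → G) :
    walk y (consSeq s ξ) = consSeq y (walk (y * s) ξ) := by
  funext n
  cases n with
  | zero => rfl
  | succ n =>
    change walk y (consSeq s ξ) (n + 1) = walk (y * s) ξ n
    induction n with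
    | zero => rfl
    | succ n ih =>
      rw [walk, ih, walk]
      rfl

/-- The Markov property at time one. -/
theorem walkLaw_eq_sum (hT : ∀ s, s ∈ T ↔ ν s ≠ 0) (y : G) {B : Set (ℕ → G)}
    (hB : MeasurableSet B) :
    walkLaw ν y B = ∑ s ∈ T, ν s * walkLaw ν (y * s) (consSeq y ⁻¹' B) := by
  rw [walkLaw, Measure.map_apply (measurable_walk y) hB,
    infinitePi_eq_sum_consSeq hT (measurable_walk y hB)]
  refine Finset.sum_congr rfl fun s _ => ?_
  rw [walkLaw, Measure.map_apply (measurable_walk _) (measurable_consSeq y hB)]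
  congr 2
  ext ξ
  simp only [Set.mem_preimage, walk_consSeq]

theorem toReal_walkLaw_eq_stepAvg (hT : ∀ s, s ∈ T ↔ ν s ≠ 0) (y : G) {B : Set (ℕ → G)}
    (hB : MeasurableSet B) :
    (walkLaw ν y B).toReal =
      stepAvg ν T (fun z => (walkLaw ν z (consSeq y ⁻¹' B)).toReal) y := by
  rw [walkLaw_eq_sum hT y hB, ENNReal.toReal_sum
    fun s _ => ENNReal.mul_ne_top (ν.apply_ne_top s) (measure_ne_top _ _)]
  simp only [ENNReal.toReal_mul, stepAvg]

theorem exists_preimage_shift_of_tail {G : Type*} [MeasurableSpace G] {A : Set (ℕ → G)}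
    (hA : MeasurableSet[tailSigma G] A) (n : ℕ) :
    ∃ B : Set (ℕ → G), MeasurableSet B ∧ (fun X : ℕ → G => fun k => X (n + k)) ⁻¹' B = A := by
  have hle : tailSigma G ≤
      MeasurableSpace.comap (fun X : ℕ → G => fun k => X (n + k)) inferInstance := by
    refine (iInf_le _ n).trans (iSup_le fun k => iSup_le fun hk => ?_)
    rintro _ ⟨D, hD, rfl⟩
    refine ⟨(fun X => X (k - n)) ⁻¹' D, measurable_pi_apply (k - n) hD, ?_⟩
    ext X
    simp [Nat.add_sub_cancel' hk]
  exact hle A hA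

/-! ### Liouville property implies trivial tail -/

/-- If bounded harmonic functions are constant then the tail σ-algebra is trivial. -/
theorem isTrivialUnder_tail_of_harmonic_const (hT : ∀ s, s ∈ T ↔ ν s ≠ 0)
    (hinv : ∀ s ∈ T, s⁻¹ ∈ T) (hne : T.Nonempty) (hgen : Subgroup.closure (T : Set G) = ⊤)
    (hL : ∀ u : G → ℝ, (∃ C : ℝ, ∀ y, |u y| ≤ C) → (∀ y, u y = stepAvg ν T u y) →
      ∃ c : ℝ, ∀ y, u y = c) (x : G) :
    IsTrivialUnder (walkLaw ν x) (tailSigma G) := by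
  classical
  intro A hA
  choose B hBm hB using exists_preimage_shift_of_tail hA
  have hA0 : B 0 = A := by
    rw [← hB 0]
    ext X
    simp
  have hcons : ∀ n y, consSeq y ⁻¹' B n = B (n + 1) := by
    intro n y
    ext X
    -- Padding `X` with `n + 1` copies of `y` gives one trajectory whose membership in `A` can be
    -- read off from time `n` or from time `n + 1`.
    have h1 : (fun k => (if k ≤ n then y else X (k - (n + 1))) : ℕ → G) ∈ A ↔
        X ∈ B (n + 1) := by
      rw [← hB (n + 1)]
      simp only [Set.mem_preimage]
      refine iff_of_eq (congrArg (· ∈ B (n + 1)) ?_)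
      funext k
      rw [if_neg (by omega), Nat.add_sub_cancel_left]
    have h2 : (fun k => (if k ≤ n then y else X (k - (n + 1))) : ℕ → G) ∈ A ↔
        consSeq y X ∈ B n := by
      rw [← hB n]
      simp only [Set.mem_preimage]
      refine iff_of_eq (congrArg (· ∈ B n) ?_)
      funext k
      cases k with
      | zero => simp [consSeq]
      | succ k =>
        rw [if_neg (by omega), consSeq]
        congr 1
        omega
    exact h2.symm.trans h1
  have hf : IsSpaceTimeHarmonic ν T fun n y => (walkLaw ν y (B n)).toReal := fun n y => by
    simp only
    rw [toReal_walkLaw_eq_stepAvg hT y (hBm n), hcons]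
  obtain ⟨c, hc⟩ := hf.exists_const hT hinv hne hgen hL (C := 1) (fun n y => by
    rw [abs_of_nonneg ENNReal.toReal_nonneg]
    exact ENNReal.toReal_mono ENNReal.one_ne_top prob_le_one) x
  set c' : ℝ≥0∞ := walkLaw ν x A with hc'
  have hreach : ∀ m, ∀ g ∈ (T : Set G) ^ m, walkLaw ν (x * g) (B m) = c' := by
    intro m g hg
    rw [← ENNReal.toReal_eq_toReal_iff' (measure_ne_top _ _) (measure_ne_top _ _), hc m g hg,
      ← hc 0 1 (by simp), mul_one, hA0]
  set μ := Measure.infinitePi fun _ : ℕ => ν.toMeasure with hμ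
  -- Independence of the event and every cylinder of increments; the induction peels off the first
  -- increment, so it must range over all reachable points.
  have hbox : ∀ n m, ∀ g ∈ (T : Set G) ^ m, ∀ t : ℕ → Set G,
      μ (walk (x * g) ⁻¹' B m ∩ {ξ | ∀ i < n, ξ i ∈ t i}) =
        c' * ∏ i ∈ Finset.range n, ν.toMeasure (t i) := by
    intro n
    induction n with
    | zero =>
      intro m g hg t
      rw [← hreach m g hg, walkLaw, Measure.map_apply (measurable_walk _) (hBm m)]
      simp [hμ]
    | succ n ih =>
      intro m g hg t
      rw [hμ, infinitePi_eq_sum_consSeq hT ((measurable_walk _ (hBm m)).inter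
        (measurableSet_forall_lt (n + 1) fun i => .of_discrete)), ← hμ, Finset.prod_range_succ',
        toMeasure_eq_sum hT (t 0), mul_comm (∏ i ∈ Finset.range n, _), Finset.sum_mul,
        Finset.mul_sum]
      refine Finset.sum_congr rfl fun s hs => ?_
      have hwalk : consSeq s ⁻¹' (walk (x * g) ⁻¹' B m) = walk (x * (g * s)) ⁻¹' B (m + 1) := by
        rw [← hcons m (x * g)]
        ext ξ
        simp only [Set.mem_preimage, walk_consSeq, mul_assoc]
      rw [Set.preimage_inter, setOf_forall_consSeq, hwalk]
      split_ifs
      · rw [ih (m + 1) (g * s) (pow_succ (T : Set G) m ▸ Set.mul_mem_mul hg hs)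
          fun i => t (i + 1)]
        ring
      · simp
  have hAm : MeasurableSet A := tailSigma_le G A hA
  have hA' : c' = μ (walk x ⁻¹' A) := by rw [hc', walkLaw, Measure.map_apply (measurable_walk x) hAm]
  rcases eq_or_ne c' 0 with h0 | h0
  · exact Or.inl h0
  right
  have htop : c' ≠ ∞ := measure_ne_top _ _
  have hm : MeasurableSet (walk x ⁻¹' A) := measurable_walk x hAm
  -- Conditioning on `A` leaves the law of the increments unchanged, so the complement of `A` is
  -- null.
  have hρ : c'⁻¹ • μ.restrict (walk x ⁻¹' A) = μ := by
    refine eq_infinitePi_of_range fun n t ht => ?_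
    have := hbox n 0 1 (by simp) t
    rw [mul_one, hA0] at this
    rw [Measure.smul_apply, Measure.restrict_apply (measurableSet_forall_lt n ht), Set.inter_comm,
      this, smul_eq_mul, ← mul_assoc, ENNReal.inv_mul_cancel h0 htop, one_mul]
  have hcompl : μ (walk x ⁻¹' A)ᶜ = 0 := by
    rw [← hρ, Measure.smul_apply, Measure.restrict_apply hm.compl]
    simp
  rw [hA']
  exact (prob_compl_eq_zero_iff hm).1 hcompl

/-! ### Trivial tail implies Liouville property -/

/-- The trajectories that visit `D` infinitely often. -/
def visitsInfinitelyOften {G : Type*} (D : Set G) : Set (ℕ → G) :=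
  {X | ∀ N, ∃ n, N ≤ n ∧ X n ∈ D}

theorem measurableSet_tail_visitsInfinitelyOften {G : Type*} [MeasurableSpace G] {D : Set G}
    (hD : MeasurableSet D) : MeasurableSet[tailSigma G] (visitsInfinitelyOften D) := by
  rw [MeasurableSpace.measurableSet_iInf]
  intro m
  have : visitsInfinitelyOften D =
      ⋂ N : ℕ, ⋃ n : ℕ, ⋃ _ : N ≤ n ∧ m ≤ n, (fun X : ℕ → G => X n) ⁻¹' D := by
    ext X
    simp only [visitsInfinitelyOften, Set.mem_ofPred_eq, Set.mem_iInter, Set.mem_iUnion,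
      Set.mem_preimage, exists_prop]
    refine ⟨fun h N => ?_, fun h N => ?_⟩
    · obtain ⟨n, hn, hX⟩ := h (max N m)
      exact ⟨n, max_le_iff.1 hn, hX⟩
    · obtain ⟨n, hn, hX⟩ := h N
      exact ⟨n, hn.1, hX⟩
  rw [this]
  refine MeasurableSet.iInter fun N => MeasurableSet.iUnion fun n => MeasurableSet.iUnion fun h => ?_
  have hle : MeasurableSpace.comap (fun X : ℕ → G => X n) inferInstance ≤
      ⨆ k : ℕ, ⨆ _ : m ≤ k, MeasurableSpace.comap (fun X : ℕ → G => X k) inferInstance :=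
    le_iSup₂_of_le n h.2 le_rfl
  exact hle _ ⟨D, hD, rfl⟩

theorem consSeq_mem_visitsInfinitelyOften {G : Type*} {D : Set G} (y : G) (X : ℕ → G) :
    consSeq y X ∈ visitsInfinitelyOften D ↔ X ∈ visitsInfinitelyOften D := by
  refine ⟨fun h N => ?_, fun h N => ?_⟩
  · obtain ⟨n, hn, hX⟩ := h (N + 1)
    obtain ⟨n, rfl⟩ : ∃ k, n = k + 1 := ⟨n - 1, by omega⟩
    exact ⟨n, by omega, hX⟩
  · obtain ⟨n, hn, hX⟩ := h N
    exact ⟨n + 1, by omega, hX⟩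

/-- A bounded harmonic function that is at least `r` on a set which the walk from `y` hits almost
surely is at least `r` at `y`. -/
theorem le_of_ae_hits (hT : ∀ s, s ∈ T ↔ ν s ≠ 0) {u : G → ℝ} {C : ℝ} (hC : ∀ y, |u y| ≤ C)
    (hu : ∀ y, u y = stepAvg ν T u y) {r : ℝ} {D : Set G} (hr : ∀ y ∈ D, r ≤ u y) {y : G}
    (hy : walkLaw ν y {X | ∀ n, X n ∉ D} = 0) : r ≤ u y := by
  have hC0 : 0 ≤ C := (abs_nonneg _).trans (hC 1)
  -- Optional stopping at the hitting time of `D`, by induction on the horizon: only paths that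
  -- avoid `D` before time `N` contribute, each at most `|r| + C`.
  have hbound : ∀ N y, r - u y ≤
      (|r| + C) * (walkLaw ν y {X | ∀ i < N, X i ∈ Dᶜ}).toReal := by
    intro N
    induction N with
    | zero =>
      intro y
      have h1 := abs_le.1 (hC y)
      have h2 := le_abs_self r
      simp only [not_lt_zero, false_imp_iff, implies_true, Set.ofPred_true, measure_univ,
        ENNReal.toReal_one, mul_one]
      linarith
    | succ N ih =>
      intro y
      by_cases hyD : y ∈ D
      · exact (sub_nonpos.2 (hr y hyD)).trans (by positivity)
      · rw [toReal_walkLaw_eq_stepAvg hT y (measurableSet_forall_lt _ fun i => .of_discrete),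
          setOf_forall_consSeq y N fun _ => Dᶜ, if_pos (Set.mem_compl hyD)]
        conv_lhs => rw [hu y, ← stepAvg_const hT r y, ← stepAvg_sub]
        rw [stepAvg, stepAvg, Finset.mul_sum]
        refine Finset.sum_le_sum fun s _ => ?_
        rw [mul_left_comm]
        exact mul_le_mul_of_nonneg_left (ih _) ENNReal.toReal_nonneg
  have hlim : Filter.Tendsto (fun N => walkLaw ν y {X | ∀ i < N, X i ∈ Dᶜ}) Filter.atTop
      (nhds (walkLaw ν y (⋂ N : ℕ, {X | ∀ i < N, X i ∈ Dᶜ}))) := by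
    refine tendsto_measure_iInter_atTop (fun N => (measurableSet_forall_lt N
      fun _ => .of_discrete).nullMeasurableSet) (fun M N h X hX i hi => hX i (hi.trans_le h))
      ⟨0, measure_ne_top _ _⟩
  have hzero : walkLaw ν y (⋂ N : ℕ, {X | ∀ i < N, X i ∈ Dᶜ}) = 0 := by
    refine measure_mono_null ?_ hy
    intro X hX n
    exact Set.mem_iInter.1 hX (n + 1) n n.lt_succ_self
  rw [hzero] at hlim
  have hlim' := ((ENNReal.tendsto_toReal ENNReal.zero_ne_top).comp hlim).const_mul (|r| + C)
  rw [ENNReal.toReal_zero, mul_zero] at hlim'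
  exact sub_nonpos.1 (ge_of_tendsto' hlim' fun N => hbound N y)

/-- Infinite recurrence to `D` ignores the first step, so holding almost surely from `x` it holds
almost surely from every point reachable from `x`, which is all of `G`. -/
theorem le_of_ae_visitsInfinitelyOften (hT : ∀ s, s ∈ T ↔ ν s ≠ 0) (hinv : ∀ s ∈ T, s⁻¹ ∈ T)
    (hgen : Subgroup.closure (T : Set G) = ⊤) {u : G → ℝ} {C : ℝ} (hC : ∀ y, |u y| ≤ C)
    (hu : ∀ y, u y = stepAvg ν T u y) {r : ℝ} {D : Set G} (hr : ∀ y ∈ D, r ≤ u y) {x : G}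
    (hx : walkLaw ν x (visitsInfinitelyOften D)ᶜ = 0) (y : G) : r ≤ u y := by
  have hm : MeasurableSet (visitsInfinitelyOften D)ᶜ :=
    (tailSigma_le G _ (measurableSet_tail_visitsInfinitelyOften .of_discrete)).compl
  have hword : ∀ k, ∀ g ∈ (T : Set G) ^ k, walkLaw ν (x * g) (visitsInfinitelyOften D)ᶜ = 0 := by
    intro k
    induction k with
    | zero =>
      intro g hg
      rw [pow_zero, Set.mem_one] at hg
      rwa [hg, mul_one]
    | succ k ih =>
      intro g hg
      rw [pow_succ] at hg
      obtain ⟨g, hg, s, hs, rfl⟩ := hg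
      have h := ih g hg
      rw [walkLaw_eq_sum hT _ hm, Finset.sum_eq_zero_iff] at h
      have hpre : consSeq (x * g) ⁻¹' (visitsInfinitelyOften D)ᶜ = (visitsInfinitelyOften D)ᶜ := by
        ext X
        exact not_congr (consSeq_mem_visitsInfinitelyOften _ _)
      have := (mul_eq_zero.1 (h s hs)).resolve_left ((hT s).1 hs)
      rwa [hpre, mul_assoc] at this
  obtain ⟨k, hk⟩ := exists_mem_pow hinv hgen (x⁻¹ * y)
  have hy := hword k _ hk
  rw [mul_inv_cancel_left] at hy
  refine le_of_ae_hits hT hC hu hr (measure_mono_null ?_ hy)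
  intro X hX hio
  obtain ⟨n, -, hn⟩ := hio 0
  exact hX n hn

/-- If the tail σ-algebra is trivial then bounded harmonic functions are constant. -/
theorem harmonic_const_of_isTrivialUnder_tail (hT : ∀ s, s ∈ T ↔ ν s ≠ 0)
    (hinv : ∀ s ∈ T, s⁻¹ ∈ T) (hgen : Subgroup.closure (T : Set G) = ⊤) {x : G}
    (htriv : IsTrivialUnder (walkLaw ν x) (tailSigma G)) {u : G → ℝ} {C : ℝ}
    (hC : ∀ y, |u y| ≤ C) (hu : ∀ y, u y = stepAvg ν T u y) : ∃ c : ℝ, ∀ y, u y = c := by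
  have hdich : ∀ r : ℝ, (∀ y, r ≤ u y) ∨ ∀ y, u y ≤ r := by
    intro r
    have htail := measurableSet_tail_visitsInfinitelyOften (D := {y : G | r ≤ u y}) .of_discrete
    rcases htriv _ htail with h | h
    -- Almost surely the walk eventually stays in `{u < r}`, so the minimum principle applies to
    -- `-u`.
    · right
      intro y
      refine neg_le_neg_iff.1 (le_of_ae_visitsInfinitelyOften hT hinv hgen (u := fun y => -u y)
        (C := C) (by simpa using hC) (fun y => by rw [stepAvg_neg, ← hu y]) (D := {y | u y ≤ r})
        (fun y hy => neg_le_neg hy) (x := x) (measure_mono_null ?_ h) y)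
      intro X hX N
      by_contra! hN
      refine hX fun M => ⟨max M N, le_max_left _ _, ?_⟩
      exact (not_le.1 (show ¬r ≤ u (X (max M N)) from hN _ (le_max_right _ _))).le
    · left
      refine le_of_ae_visitsInfinitelyOften hT hinv hgen hC hu (D := {y | r ≤ u y})
        (fun y hy => hy) (x := x) ?_
      exact (prob_compl_eq_zero_iff (tailSigma_le G _ htail)).2 h
  refine ⟨u 1, fun y => ?_⟩
  by_contra hne
  rcases lt_or_gt_of_ne hne with h | h <;> obtain ⟨r, h1, h2⟩ := exists_between h <;>
    rcases hdich r with hr | hr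
  · exact (hr y).not_gt h1
  · exact (hr 1).not_gt h2
  · exact (hr 1).not_gt h1
  · exact (hr y).not_gt h2

theorem isTrivialUnder_tail_iff (hT : ∀ s, s ∈ T ↔ ν s ≠ 0) (hinv : ∀ s ∈ T, s⁻¹ ∈ T)
    (hne : T.Nonempty) (hgen : Subgroup.closure (T : Set G) = ⊤) (x : G) :
    IsTrivialUnder (walkLaw ν x) (tailSigma G) ↔
      ∀ u : G → ℝ, (∃ C : ℝ, ∀ y, |u y| ≤ C) → (∀ y, u y = stepAvg ν T u y) →
        ∃ c : ℝ, ∀ y, u y = c :=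
  ⟨fun h _ ⟨_, hC⟩ hu => harmonic_const_of_isTrivialUnder_tail hT hinv hgen h hC hu,
    fun h => isTrivialUnder_tail_of_harmonic_const hT hinv hne hgen h x⟩

/-! ### The simple and lazy step laws -/

theorem stepAvg_srwStep {G : Type*} [Group G] (S : Finset G) (hS : S.Nonempty) (u : G → ℝ) (y : G) :
    stepAvg (srwStep S hS) S u y = (1 / (S.card : ℝ)) * ∑ s ∈ S, u (y * s) := by
  rw [stepAvg, Finset.mul_sum]
  refine Finset.sum_congr rfl fun s hs => ?_
  rw [srwStep, PMF.uniformOfFinset_apply_of_mem hS hs]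
  simp

theorem mem_iff_srwStep_ne_zero {G : Type*} [Group G] (S : Finset G) (hS : S.Nonempty) (s : G) :
    s ∈ S ↔ srwStep S hS s ≠ 0 := by
  rw [← PMF.mem_support_iff, srwStep, PMF.mem_support_uniformOfFinset_iff]

open Classical in
theorem lazyStep_apply {G : Type*} [Group G] (S : Finset G) (hS : S.Nonempty) (s : G) :
    lazyStep S hS s = 2⁻¹ * (if s = 1 then 1 else 0) + 2⁻¹ * srwStep S hS s := by
  rw [lazyStep, PMF.bind_apply, tsum_bool]
  simp [PMF.uniformOfFintype_apply, PMF.pure_apply, add_comm]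

open Classical in
theorem mem_iff_lazyStep_ne_zero {G : Type*} [Group G] (S : Finset G) (hS : S.Nonempty) (s : G) :
    s ∈ insert 1 S ↔ lazyStep S hS s ≠ 0 := by
  rw [lazyStep_apply, Finset.mem_insert, mem_iff_srwStep_ne_zero S hS s]
  by_cases h : s = 1 <;> simp [h]

open Classical in
theorem stepAvg_lazyStep {G : Type*} [Group G] (S : Finset G) (hS : S.Nonempty) (u : G → ℝ)
    (y : G) :
    stepAvg (lazyStep S hS) (insert 1 S) u y =
      2⁻¹ * u y + 2⁻¹ * ((1 / (S.card : ℝ)) * ∑ s ∈ S, u (y * s)) := by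
  have hsub : ∑ s ∈ insert 1 S, (srwStep S hS s).toReal * u (y * s) =
      stepAvg (srwStep S hS) S u y := by
    refine (Finset.sum_subset (Finset.subset_insert 1 S) fun s _ hs => ?_).symm
    rw [mem_iff_srwStep_ne_zero S hS, not_not] at hs
    simp [hs]
  have hone : ∑ s ∈ insert 1 S, (if s = 1 then (1 : ℝ) else 0) * u (y * s) = u y := by
    simp
  rw [← stepAvg_srwStep S hS, ← hsub]
  conv_rhs => rw [← hone]
  rw [stepAvg, Finset.mul_sum, Finset.mul_sum, ← Finset.sum_add_distrib]
  refine Finset.sum_congr rfl fun s _ => ?_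
  rw [lazyStep_apply, ENNReal.toReal_add (by split_ifs <;> simp)
    (ENNReal.mul_ne_top (by simp) ((srwStep S hS).apply_ne_top s)), ENNReal.toReal_mul,
    ENNReal.toReal_mul]
  split_ifs <;> simp <;> ring

end GroupWalk

theorem mainTheorem11 {G : Type*} [Group G] [Countable G]
    [MeasurableSpace G] [DiscreteMeasurableSpace G]
    (S : Finset G) (hS : S.Nonempty) (hsymm : ∀ s ∈ S, s⁻¹ ∈ S)
    (hgen : Subgroup.closure (S : Set G) = ⊤) (x : G) :
    (GroupWalk.IsTrivialUnder (GroupWalk.walkLaw (GroupWalk.srwStep S hS) x)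
        (GroupWalk.tailSigma G) ↔
      GroupWalk.BoundedHarmonicConstant S) ∧
    (GroupWalk.IsTrivialUnder (GroupWalk.walkLaw (GroupWalk.lazyStep S hS) x)
        (GroupWalk.tailSigma G) ↔
      GroupWalk.BoundedHarmonicConstant S) := by
  classical
  constructor
  · rw [GroupWalk.isTrivialUnder_tail_iff (GroupWalk.mem_iff_srwStep_ne_zero S hS) hsymm hS hgen]
    simp only [GroupWalk.BoundedHarmonicConstant, GroupWalk.IsHarmonic, GroupWalk.stepAvg_srwStep]
  · have hinv : ∀ s ∈ insert 1 S, s⁻¹ ∈ insert 1 S := by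
      intro s hs
      rcases Finset.mem_insert.1 hs with rfl | hs
      · simp
      · exact Finset.mem_insert_of_mem (hsymm s hs)
    have hgen' : Subgroup.closure ((insert 1 S : Finset G) : Set G) = ⊤ := by
      rw [Finset.coe_insert, Subgroup.closure_insert_one, hgen]
    rw [GroupWalk.isTrivialUnder_tail_iff (GroupWalk.mem_iff_lazyStep_ne_zero S hS) hinv
      (Finset.insert_nonempty 1 S) hgen']
    have hiff : ∀ a b : ℝ, a = 2⁻¹ * a + 2⁻¹ * b ↔ a = b := fun a b =>
      ⟨fun h => by linarith, fun h => by linarith⟩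
    simp only [GroupWalk.BoundedHarmonicConstant, GroupWalk.IsHarmonic, GroupWalk.stepAvg_lazyStep,
      hiff]
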